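/- For a real $m\times n$ matrix $J$, a set of row indices $S\subseteq\{1,\dots,m\}$ and $\lambda\ge 0$, let $J_S$ be the submatrix of rows of $J$ indexed by $S$, let $J_S^{+(\lambda)}=(J_S^\top J_S+\lambda I)^{-1}J_S^\top$ if $\lambda>0$ and $J_S^{+(0)}=J_S^{+}$ (the Moore–Penrose pseudoinverse), and let $P(S)=J_S^{+(\lambda)}J_S$. For a random block $S$ put $\overline P=\mathbb E_S[P(S)]$. Two $n\times n$ matrices are said to share an eigenbasis if there is an orthonormal basis of $\mathbb R^n$ all of whose members are eigenvectors of both. Then $\overline P$ shares an eigenbasis with $J^\top J$ in the following two cases. 1. (DPP sampling.) Let $J\in\mathbb R^{m\times n}$ be arbitrary, let $k\in\mathbb N$ and $\lambda\ge 0$, and let $S$ be drawn from $k\text{-}\mathrm{DPP}(JJ^\top+\lambda I)$, i.e. $$\Pr[S]=\frac{\det(J_SJ_S^\top+\lambda I)}{\sum_{|S'|=k}\det(J_{S'}J_{S'}^\top+\lambda I)}\qquad(|S|=k),$$ where the denominator is assumed to be nonzero. Then $\overline P$ shares an eigenbasis with $J^\top J$. 2. (Gaussian data, asymptotically.) Let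 $n,k\in\mathbb N$ and $\lambda\ge 0$ be fixed, let $\Sigma\in\mathbb R^{n\times n}$ be symmetric positive semidefinite, let $x_1,x_2,\dots$ be independent $\mathcal N(0,\Sigma)$ random vectors, let $J_m$ be the $m\times n$ matrix with rows $x_1,\dots,x_m$, and for $m\ge k$ let $\overline P_m$ be the matrix $\overline P$ for $J=J_m$ and $S$ drawn uniformly from the $k$-element subsets of $\{1,\dots,m\}$ (the expectation being over $S$ only, for given $J_m$). Then the condition holds in the limit $m\to\infty$: there is a deterministic matrix $\overline P_\infty$, depending only on $n,k,\lambda,\Sigma$, such that $\overline P_\infty$ and $\Sigma$ share an eigenbasis and, almost surely, $$\overline P_m\to\overline P_\infty\qquad\text{and}\qquad \tfrac1m J_m^\top J_m\to\Sigma\qquad(m\to\infty).$$ -/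

import Mathlib

open Matrix MeasureTheory ProbabilityTheory Filter
open scoped Topology

noncomputable section

/-- `A` and `B` share an eigenbasis: some orthonormal basis of `ℝⁿ` consists of vectors that are
eigenvectors of both `A` and `B`. -/
def SharesEigenbasis {n : ℕ} (A B : Matrix (Fin n) (Fin n) ℝ) : Prop :=
  ∃ b : OrthonormalBasis (Fin n) ℝ (EuclideanSpace ℝ (Fin n)),
    ∀ i, (∃ α : ℝ, A *ᵥ (b i).ofLp = α • (b i).ofLp) ∧
      (∃ β : ℝ, B *ᵥ (b i).ofLp = β • (b i).ofLp)

/-- The four Penrose conditions: `X` is the Moore-Penrose pseudoinverse of the real matrix `A`. -/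
structure IsPseudoinverse {ι κ : Type*} [Fintype ι] [Fintype κ]
    (A : Matrix ι κ ℝ) (X : Matrix κ ι ℝ) : Prop where
  mul_mul_self : A * X * A = A
  self_mul_mul : X * A * X = X
  left_symm : (A * X)ᵀ = A * X
  right_symm : (X * A)ᵀ = X * A

/-- A symmetric matrix has a symmetric generalized inverse that commutes with it. -/
theorem exists_symm_inverse {κ : Type*} [Fintype κ] [DecidableEq κ]
    (M : Matrix κ κ ℝ) (hM : Mᵀ = M) :
    ∃ N : Matrix κ κ ℝ, Nᵀ = N ∧ M * N = N * M ∧ M * N * M = M ∧ N * M * N = N := by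
  have hH : M.IsHermitian := by
    rw [Matrix.IsHermitian, Matrix.conjTranspose_eq_transpose_of_trivial, hM]
  set U : Matrix κ κ ℝ := (hH.eigenvectorUnitary : Matrix κ κ ℝ) with hU
  have hUU : Uᵀ * U = 1 := by
    have := Unitary.coe_star_mul_self hH.eigenvectorUnitary
    rwa [Matrix.star_eq_conjTranspose, Matrix.conjTranspose_eq_transpose_of_trivial] at this
  set d : κ → ℝ := hH.eigenvalues with hd
  have hMd : M = U * diagonal d * Uᵀ := by
    have h := hH.spectral_theorem
    rw [Unitary.conjStarAlgAut_apply, Matrix.star_eq_conjTranspose,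
      Matrix.conjTranspose_eq_transpose_of_trivial] at h
    exact h
  have key : ∀ a b : κ → ℝ, (U * diagonal a * Uᵀ) * (U * diagonal b * Uᵀ)
      = U * diagonal (fun i => a i * b i) * Uᵀ := by
    intro a b
    calc (U * diagonal a * Uᵀ) * (U * diagonal b * Uᵀ)
        = U * diagonal a * (Uᵀ * U) * diagonal b * Uᵀ := by simp only [Matrix.mul_assoc]
      _ = U * (diagonal a * diagonal b) * Uᵀ := by
          rw [hUU, Matrix.mul_one]; simp only [Matrix.mul_assoc]
      _ = _ := by rw [diagonal_mul_diagonal]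
  refine ⟨U * diagonal (fun i => (d i)⁻¹) * Uᵀ, ?_, ?_, ?_, ?_⟩
  · simp [Matrix.mul_assoc]
  · rw [hMd, key, key]; simp only [mul_comm]
  · rw [hMd, key, key]
    congr 3; funext i
    by_cases h : d i = 0 <;> simp [h]
  · rw [hMd, key, key]
    congr 3; funext i
    by_cases h : d i = 0 <;> simp [h]

theorem exists_isPseudoinverse {ι κ : Type*} [Fintype ι] [Fintype κ]
    (A : Matrix ι κ ℝ) : ∃ X : Matrix κ ι ℝ, IsPseudoinverse A X := by
  classical
  obtain ⟨N, hN, hc, h1, h2⟩ := exists_symm_inverse (Aᵀ * A) (by simp)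
  have hA : A * N * (Aᵀ * A) = A := by
    have h0 : (A * N * (Aᵀ * A) - A)ᵀ * (A * N * (Aᵀ * A) - A) = 0 := by
      have e1 : (A * N * (Aᵀ * A) - A)ᵀ = (Aᵀ * A) * N * Aᵀ - Aᵀ := by
        simp [hN, Matrix.mul_assoc]
      rw [e1]
      have e2 : (Aᵀ * A * N * Aᵀ - Aᵀ) * (A * N * (Aᵀ * A) - A)
          = (Aᵀ * A * N * (Aᵀ * A)) * N * (Aᵀ * A) - Aᵀ * A * N * (Aᵀ * A)
            - (Aᵀ * A * N * (Aᵀ * A)) + Aᵀ * A := by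
        simp only [Matrix.sub_mul, Matrix.mul_sub, Matrix.mul_assoc]
        abel
      rw [e2, h1, h1]; simp
    rw [← Matrix.conjTranspose_eq_transpose_of_trivial,
      Matrix.conjTranspose_mul_self_eq_zero] at h0
    exact sub_eq_zero.mp h0
  refine ⟨N * Aᵀ, ?_, ?_, ?_, ?_⟩
  · simpa only [Matrix.mul_assoc] using hA
  · have : N * Aᵀ * A * (N * Aᵀ) = (N * (Aᵀ * A) * N) * Aᵀ := by simp only [Matrix.mul_assoc]
    rw [this, h2]
  · simp [hN, Matrix.mul_assoc]
  · have : N * Aᵀ * A = N * (Aᵀ * A) := by simp only [Matrix.mul_assoc]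
    rw [this, Matrix.transpose_mul, hN, ← hc]; simp

/-- The Moore-Penrose pseudoinverse `A⁺`. -/
def pseudoinverse {ι κ : Type*} [Fintype ι] [Fintype κ] (A : Matrix ι κ ℝ) : Matrix κ ι ℝ :=
  Classical.choose (exists_isPseudoinverse A)

theorem isPseudoinverse_pseudoinverse {ι κ : Type*} [Fintype ι] [Fintype κ]
    (A : Matrix ι κ ℝ) : IsPseudoinverse A (pseudoinverse A) :=
  Classical.choose_spec (exists_isPseudoinverse A)

/-- The regularized pseudoinverse `A^{+(lam)} = (Aᵀ A + lam I)⁻¹ Aᵀ`, which for `lam = 0` is the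
Moore-Penrose pseudoinverse `A⁺`. -/
def regPseudoinverse {ι κ : Type*} [Fintype ι] [Fintype κ] [DecidableEq κ]
    (A : Matrix ι κ ℝ) (lam : ℝ) : Matrix κ ι ℝ :=
  if lam = 0 then pseudoinverse A
  else (Aᵀ * A + lam • (1 : Matrix κ κ ℝ))⁻¹ * Aᵀ

/-- The rows of `J` with index in the block `S`. -/
def rowBlock {m n : ℕ} (J : Matrix (Fin m) (Fin n) ℝ) (S : Finset (Fin m)) :
    Matrix S (Fin n) ℝ :=
  J.submatrix (fun i : S => (i : Fin m)) id

/-- The regularized projector `P(S) = J_S^{+(lam)} J_S` onto the row space of `J_S`. -/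
def regProjector {m n : ℕ} (J : Matrix (Fin m) (Fin n) ℝ) (lam : ℝ) (S : Finset (Fin m)) :
    Matrix (Fin n) (Fin n) ℝ :=
  regPseudoinverse (rowBlock J S) lam * rowBlock J S

/-- The expected projector `P̄ = 𝔼_S P(S)` when the random block `S` has probability mass
function `p`. -/
def expectedProjector {m n : ℕ} (J : Matrix (Fin m) (Fin n) ℝ) (lam : ℝ)
    (p : Finset (Fin m) → ℝ) : Matrix (Fin n) (Fin n) ℝ :=
  ∑ S : Finset (Fin m), p S • regProjector J lam S

/-- The sum of the principal minors of size `k` of the kernel `K`. -/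
def kDPPNormalizer {m : ℕ} (K : Matrix (Fin m) (Fin m) ℝ) (k : ℕ) : ℝ :=
  ∑ S ∈ (Finset.univ : Finset (Fin m)).powersetCard k,
    (K.submatrix (fun i : S => (i : Fin m)) (fun i : S => (i : Fin m))).det

/-- The probability mass function of the `k`-DPP with kernel `K`: blocks of size `k` are drawn
with probability proportional to the corresponding principal minor of `K`. -/
def kDPP {m : ℕ} (K : Matrix (Fin m) (Fin m) ℝ) (k : ℕ) (S : Finset (Fin m)) : ℝ :=
  if S.card = k then
    (K.submatrix (fun i : S => (i : Fin m)) (fun i : S => (i : Fin m))).det / kDPPNormalizer K k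
  else 0

/-- The probability mass function of a block of size `k` drawn uniformly without replacement from
`m` indices, for `k ≤ m`. -/
def uniformBlock (m k : ℕ) (S : Finset (Fin m)) : ℝ :=
  if S.card = k then 1 / (m.choose k : ℝ) else 0

/-- The `m × n` matrix whose rows are the first `m` vectors of the sequence `x`. -/
def firstRows {n : ℕ} (x : ℕ → EuclideanSpace ℝ (Fin n)) (m : ℕ) : Matrix (Fin m) (Fin n) ℝ :=
  Matrix.of fun i j => x i j

theorem IsPseudoinverse.unique {ι κ : Type*} [Fintype ι] [Fintype κ]
    {A : Matrix ι κ ℝ} {X Y : Matrix κ ι ℝ} (hX : IsPseudoinverse A X) (hY : IsPseudoinverse A Y) :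
    X = Y := by
  have h1 : A * X = A * Y := by
    calc A * X = (A * Y * A) * X := by rw [hY.mul_mul_self]
      _ = (A * Y)ᵀ * (A * X)ᵀ := by rw [hY.left_symm, hX.left_symm]; simp only [Matrix.mul_assoc]
      _ = ((A * X * A) * Y)ᵀ := by rw [← Matrix.transpose_mul]; simp only [Matrix.mul_assoc]
      _ = A * Y := by rw [hX.mul_mul_self, hY.left_symm]
  have h2 : X * A = Y * A := by
    calc X * A = X * (A * Y * A) := by rw [hY.mul_mul_self]
      _ = (X * A)ᵀ * (Y * A)ᵀ := by rw [hY.right_symm, hX.right_symm]; simp only [Matrix.mul_assoc]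
      _ = (Y * (A * X * A))ᵀ := by rw [← Matrix.transpose_mul]; simp only [Matrix.mul_assoc]
      _ = Y * A := by rw [hX.mul_mul_self, hY.right_symm]
  calc X = X * A * X := hX.self_mul_mul.symm
    _ = Y * (A * X) := by rw [h2, Matrix.mul_assoc]
    _ = Y := by rw [h1, ← Matrix.mul_assoc, hY.self_mul_mul]

/-- The kernel `J Jᵀ + lam I` restricted to a block `S` is `J_S J_Sᵀ + lam I`. -/
theorem kernel_submatrix {m n : ℕ} (J : Matrix (Fin m) (Fin n) ℝ) (lam : ℝ)
    (S : Finset (Fin m)) :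
    (J * Jᵀ + lam • (1 : Matrix (Fin m) (Fin m) ℝ)).submatrix
        (fun i : S => (i : Fin m)) (fun i : S => (i : Fin m)) =
      rowBlock J S * (rowBlock J S)ᵀ + lam • (1 : Matrix S S ℝ) := by
  ext i j
  by_cases h : i = j
  · subst h; simp [rowBlock, Matrix.mul_apply]
  · have h' : (i : Fin m) ≠ (j : Fin m) := fun e => h (Subtype.ext e)
    simp [rowBlock, Matrix.mul_apply, Matrix.one_apply_ne h, Matrix.one_apply_ne h']

theorem kDPP_nonneg {m : ℕ} {K : Matrix (Fin m) (Fin m) ℝ} (hK : K.PosSemidef) (k : ℕ)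
    (S : Finset (Fin m)) : 0 ≤ kDPP K k S := by
  unfold kDPP kDPPNormalizer
  split_ifs
  · exact div_nonneg (hK.submatrix _).det_nonneg
      (Finset.sum_nonneg fun T _ => (hK.submatrix _).det_nonneg)
  · exact le_rfl

theorem sum_kDPP {m : ℕ} {K : Matrix (Fin m) (Fin m) ℝ} {k : ℕ} (h : kDPPNormalizer K k ≠ 0) :
    ∑ S, kDPP K k S = 1 := by
  unfold kDPP
  rw [← Finset.sum_filter, ← Finset.sum_div, div_eq_one_iff_eq h, kDPPNormalizer]
  refine Finset.sum_congr ?_ fun _ _ => rfl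
  ext S; simp [Finset.mem_powersetCard]

theorem uniformBlock_nonneg (m k : ℕ) (S : Finset (Fin m)) : 0 ≤ uniformBlock m k S := by
  unfold uniformBlock
  split_ifs <;> positivity

theorem sum_uniformBlock {m k : ℕ} (h : k ≤ m) : ∑ S, uniformBlock m k S = 1 := by
  unfold uniformBlock
  rw [← Finset.sum_filter, Finset.sum_const]
  have : (Finset.univ.filter fun S : Finset (Fin m) => S.card = k)
      = (Finset.univ : Finset (Fin m)).powersetCard k := by
    ext S; simp [Finset.mem_powersetCard]
  rw [this, Finset.card_powersetCard, Finset.card_univ, Fintype.card_fin, nsmul_eq_mul]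
  have h0 : (m.choose k : ℝ) ≠ 0 := by exact_mod_cast (Nat.choose_pos h).ne'
  field_simp

end

/-!
Both parts rest on one symmetry principle. Let `R = 1 - 2 v vᵀ` be the reflection in a unit
eigenvector `v` of a symmetric matrix `B`. A matrix `A` with `R A R = A` commutes with `v vᵀ`, so
`v` is an eigenvector of `A`. If this holds for every such `v`, any orthonormal eigenbasis of `B` is
shared by `A` (`sharesEigenbasis_of_reflectionMatrix_conj`).

*Determinantal sampling.* By the matrix determinant lemma, `det(K_S) · uᵀ P(S) w` equals
`det K_S - det (K - (J w) (J u)ᵀ)_S` with `K = J Jᵀ + lam`. Summed over `|S| = k` these are sums of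
principal minors, that is, coefficients of characteristic polynomials, so they do not change when
`K`, `J w` and `J u` are transformed by an orthogonal matrix `Q`. Since `J R = Q J`, with `Q` the
reflection in `J v` (the identity if `J v = 0`), the expected projector is fixed by conjugation with `R`.

*Gaussian rows.* The projector of a block is a bounded measurable symmetric function of its `k`
rows, so for uniform sampling the expected projector is a U-statistic. A U-statistic is the average,
over all orderings of the samples, of means over disjoint blocks. Such block means are sub-Gaussian
by Hoeffding's lemma, and averaging preserves this, so the deviation probabilities are summable in
`m` and the Borel-Cantelli lemma gives almost sure convergence to the expectation
(`ae_tendsto_uStatistic`). The limit is fixed by conjugation with reflections in eigenvectors of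
the covariance, because these preserve the Gaussian law. The sample covariance converges by the
strong law of large numbers.
-/

/-! ### Reflections and common eigenbases -/

/-- The matrix `1 - 2 v vᵀ`; for a unit vector `v` it is the orthogonal reflection in `v^⊥`. -/
def reflectionMatrix {ι : Type*} [DecidableEq ι] (v : ι → ℝ) : Matrix ι ι ℝ :=
  1 - (2 : ℝ) • vecMulVec v v

theorem reflectionMatrix_transpose {ι : Type*} [DecidableEq ι] (v : ι → ℝ) :
    (reflectionMatrix v)ᵀ = reflectionMatrix v := by
  simp [reflectionMatrix, transpose_vecMulVec]

theorem reflectionMatrix_mul_self {ι : Type*} [Fintype ι] [DecidableEq ι] {v : ι → ℝ}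
    (hv : v ⬝ᵥ v = 1) : reflectionMatrix v * reflectionMatrix v = 1 := by
  simp only [reflectionMatrix, mul_sub, sub_mul, mul_one, one_mul, smul_mul_assoc, mul_smul_comm,
    vecMulVec_mul_vecMulVec, hv, one_smul]
  module

/-- A matrix fixed by conjugation with the reflection in `v` has `v` as an eigenvector, since it
then commutes with `v vᵀ`. -/
theorem exists_mulVec_eq_smul_of_reflectionMatrix_conj {ι : Type*} [Fintype ι] [DecidableEq ι]
    {A : Matrix ι ι ℝ} {v : ι → ℝ} (hv : v ⬝ᵥ v = 1)
    (hA : reflectionMatrix v * A * reflectionMatrix v = A) : ∃ α : ℝ, A *ᵥ v = α • v := by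
  have h1 : reflectionMatrix v * A = A * reflectionMatrix v := by
    calc reflectionMatrix v * A = reflectionMatrix v * A *
          (reflectionMatrix v * reflectionMatrix v) := by
          rw [reflectionMatrix_mul_self hv, mul_one]
      _ = A * reflectionMatrix v := by rw [← mul_assoc, hA]
  have h2 : vecMulVec v v * A = A * vecMulVec v v := by
    simp only [reflectionMatrix, mul_sub, sub_mul, mul_one, one_mul, smul_mul_assoc,
      mul_smul_comm] at h1
    exact smul_right_injective _ (two_ne_zero (α := ℝ)) (sub_right_injective h1)
  refine ⟨v ⬝ᵥ A *ᵥ v, ?_⟩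
  have h3 := congrArg (· *ᵥ v) h2
  simp only [← mulVec_mulVec, vecMulVec_mulVec, hv] at h3
  simpa using h3.symm

theorem sharesEigenbasis_of_reflectionMatrix_conj {n : ℕ} {A B : Matrix (Fin n) (Fin n) ℝ}
    (hB : B.IsHermitian)
    (hA : ∀ v : Fin n → ℝ, v ⬝ᵥ v = 1 → (∃ β : ℝ, B *ᵥ v = β • v) →
      reflectionMatrix v * A * reflectionMatrix v = A) : SharesEigenbasis A B := by
  refine ⟨hB.eigenvectorBasis, fun i => ?_⟩
  have hβ : ∃ β : ℝ, B *ᵥ (hB.eigenvectorBasis i).ofLp = β • (hB.eigenvectorBasis i).ofLp :=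
    ⟨_, hB.mulVec_eigenvectorBasis i⟩
  have h1 : (hB.eigenvectorBasis i).ofLp ⬝ᵥ (hB.eigenvectorBasis i).ofLp = 1 := by
    have := hB.eigenvectorBasis.inner_eq_one i
    rw [PiLp.inner_apply] at this
    simpa [dotProduct, sq] using this
  exact ⟨exists_mulVec_eq_smul_of_reflectionMatrix_conj h1 (hA _ h1 hβ), hβ⟩

/-! ### The regularized projector of a matrix -/

theorem pseudoinverse_eq {ι κ : Type*} [Fintype ι] [Fintype κ] {A : Matrix ι κ ℝ}
    {X : Matrix κ ι ℝ} (h : IsPseudoinverse A X) : pseudoinverse A = X :=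
  (isPseudoinverse_pseudoinverse A).unique h

section RegProjector

variable {ι κ : Type*} [Fintype ι] [Fintype κ] [DecidableEq κ]

theorem posDef_transpose_mul_self_add_smul (A : Matrix ι κ ℝ) {lam : ℝ} (h : 0 < lam) :
    (Aᵀ * A + lam • (1 : Matrix κ κ ℝ)).PosDef := by
  refine Matrix.PosDef.posSemidef_add ?_ (Matrix.PosDef.one.smul h)
  simpa using posSemidef_conjTranspose_mul_self A

theorem isUnit_det_gram_add (A : Matrix ι κ ℝ) {lam : ℝ} (h : 0 < lam) :
    IsUnit (Aᵀ * A + lam • (1 : Matrix κ κ ℝ)).det :=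
  (posDef_transpose_mul_self_add_smul A h).det_pos.ne'.isUnit

theorem regPseudoinverse_zero (A : Matrix ι κ ℝ) : regPseudoinverse A 0 = pseudoinverse A :=
  if_pos rfl

theorem regPseudoinverse_of_pos (A : Matrix ι κ ℝ) {lam : ℝ} (h : 0 < lam) :
    regPseudoinverse A lam = (Aᵀ * A + lam • (1 : Matrix κ κ ℝ))⁻¹ * Aᵀ :=
  if_neg h.ne'

/-- The push-through identity `A^{+(lam)} = Aᵀ (A Aᵀ + lam)⁻¹`. -/
theorem regPseudoinverse_eq_transpose_mul_inv [DecidableEq ι] (A : Matrix ι κ ℝ) {lam : ℝ}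
    (h : 0 ≤ lam) (hK : IsUnit (A * Aᵀ + lam • (1 : Matrix ι ι ℝ)).det) :
    regPseudoinverse A lam = Aᵀ * (A * Aᵀ + lam • (1 : Matrix ι ι ℝ))⁻¹ := by
  rcases h.eq_or_lt with rfl | h
  · rw [regPseudoinverse_zero]
    simp only [zero_smul, add_zero] at hK ⊢
    have e : A * (Aᵀ * (A * Aᵀ)⁻¹) = 1 := by rw [← Matrix.mul_assoc, mul_nonsing_inv _ hK]
    refine pseudoinverse_eq ⟨?_, ?_, ?_, ?_⟩
    · rw [e, Matrix.one_mul]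
    · rw [Matrix.mul_assoc (Aᵀ * (A * Aᵀ)⁻¹), e, Matrix.mul_one]
    · rw [e, transpose_one]
    · simp [transpose_nonsing_inv, Matrix.mul_assoc]
  · rw [regPseudoinverse_of_pos A h]
    have hG := isUnit_det_gram_add A h
    have e : Aᵀ * (A * Aᵀ + lam • (1 : Matrix ι ι ℝ))
        = (Aᵀ * A + lam • (1 : Matrix κ κ ℝ)) * Aᵀ := by
      simp [Matrix.mul_add, Matrix.add_mul, Matrix.mul_assoc]
    calc (Aᵀ * A + lam • (1 : Matrix κ κ ℝ))⁻¹ * Aᵀ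
        = (Aᵀ * A + lam • (1 : Matrix κ κ ℝ))⁻¹ * (Aᵀ * (A * Aᵀ + lam • (1 : Matrix ι ι ℝ)))
            * (A * Aᵀ + lam • (1 : Matrix ι ι ℝ))⁻¹ := by
          rw [← Matrix.mul_assoc, mul_nonsing_inv_cancel_right _ _ hK]
      _ = Aᵀ * (A * Aᵀ + lam • (1 : Matrix ι ι ℝ))⁻¹ := by
          rw [e, nonsing_inv_mul_cancel_left _ _ hG]

theorem regPseudoinverse_mul_orthogonal_right (A : Matrix ι κ ℝ) {lam : ℝ} (h : 0 ≤ lam)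
    {Q : Matrix κ κ ℝ} (hQ : Qᵀ * Q = 1) :
    regPseudoinverse (A * Q) lam * (A * Q) = Qᵀ * (regPseudoinverse A lam * A) * Q := by
  have hQ' : Q * Qᵀ = 1 := mul_eq_one_comm.mp hQ
  have c1 : ∀ Y : Matrix κ κ ℝ, Q * (Qᵀ * Y) = Y := fun Y => by
    rw [← Matrix.mul_assoc, hQ', Matrix.one_mul]
  have c2 : ∀ Y : Matrix κ ι ℝ, Q * (Qᵀ * Y) = Y := fun Y => by
    rw [← Matrix.mul_assoc, hQ', Matrix.one_mul]
  rcases h.eq_or_lt with rfl | h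
  · have hp := isPseudoinverse_pseudoinverse A
    have e : pseudoinverse (A * Q) = Qᵀ * pseudoinverse A := by
      have k1 : A * Q * (Qᵀ * pseudoinverse A) = A * pseudoinverse A := by
        rw [Matrix.mul_assoc, c2]
      refine pseudoinverse_eq ⟨?_, ?_, ?_, ?_⟩
      · rw [k1, ← Matrix.mul_assoc, hp.mul_mul_self]
      · rw [Matrix.mul_assoc (Qᵀ * pseudoinverse A), k1, Matrix.mul_assoc, ← Matrix.mul_assoc _ A,
          hp.self_mul_mul]
      · rw [k1, hp.left_symm]
      · have : Qᵀ * pseudoinverse A * (A * Q) = Qᵀ * (pseudoinverse A * A) * Q := by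
          simp only [Matrix.mul_assoc]
        rw [this, transpose_mul, transpose_mul, hp.right_symm, transpose_transpose]
        simp only [Matrix.mul_assoc]
    rw [regPseudoinverse_zero, regPseudoinverse_zero, e]
    simp only [Matrix.mul_assoc]
  · rw [regPseudoinverse_of_pos _ h, regPseudoinverse_of_pos _ h]
    have hG := isUnit_det_gram_add A h
    have e : (A * Q)ᵀ * (A * Q) + lam • (1 : Matrix κ κ ℝ)
        = Qᵀ * (Aᵀ * A + lam • (1 : Matrix κ κ ℝ)) * Q := by
      simp [Matrix.mul_add, Matrix.add_mul, Matrix.mul_assoc, hQ]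
    have e2 : ((A * Q)ᵀ * (A * Q) + lam • (1 : Matrix κ κ ℝ))⁻¹
        = Qᵀ * (Aᵀ * A + lam • (1 : Matrix κ κ ℝ))⁻¹ * Q := by
      refine inv_eq_right_inv ?_
      rw [e]
      simp only [Matrix.mul_assoc, c1]
      rw [mul_nonsing_inv_cancel_left _ _ hG, hQ]
    rw [e2]
    simp only [Matrix.mul_assoc, Matrix.transpose_mul, c2]

/-- Reordering the rows of a matrix does not change its regularized projector. -/
theorem regPseudoinverse_submatrix_mul {τ : Type*} [Fintype τ] (A : Matrix ι κ ℝ) {lam : ℝ}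
    (h : 0 ≤ lam) (e : τ ≃ ι) :
    regPseudoinverse (A.submatrix e id) lam * A.submatrix e id = regPseudoinverse A lam * A := by
  have key : ∀ X : Matrix κ ι ℝ, X.submatrix id e * A.submatrix e id = X * A := fun X => by
    rw [submatrix_mul_equiv, submatrix_id_id]
  rcases h.eq_or_lt with rfl | h
  · have hp := isPseudoinverse_pseudoinverse A
    have e : pseudoinverse (A.submatrix e id) = (pseudoinverse A).submatrix id e := by
      have k2 : A.submatrix e id * (pseudoinverse A).submatrix id e
          = (A * pseudoinverse A).submatrix e e := by
        rw [← submatrix_mul_equiv (e₂ := Equiv.refl κ)]; rfl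
      refine pseudoinverse_eq ⟨?_, ?_, ?_, ?_⟩
      · rw [Matrix.mul_assoc, key]
        conv_rhs => rw [← hp.mul_mul_self, Matrix.mul_assoc]
        rfl
      · rw [key]
        conv_rhs => rw [← hp.self_mul_mul]
        rfl
      · rw [k2, transpose_submatrix, hp.left_symm]
      · rw [key, hp.right_symm]
    rw [regPseudoinverse_zero, regPseudoinverse_zero, e, key]
  · rw [regPseudoinverse_of_pos _ h, regPseudoinverse_of_pos _ h, transpose_submatrix,
      Matrix.mul_assoc, key, Matrix.mul_assoc]

/-- Every regularized projector `P` is symmetric with `P² ≤ P`, so its entries are at most `1` in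
absolute value. -/
theorem abs_regPseudoinverse_mul_apply_le (A : Matrix ι κ ℝ) {lam : ℝ} (h : 0 ≤ lam) (a b : κ) :
    |(regPseudoinverse A lam * A) a b| ≤ 1 := by
  suffices hs : ∀ P : Matrix κ κ ℝ, Pᵀ = P → (P - P * P).PosSemidef → |P a b| ≤ 1 by
    rcases h.eq_or_lt with rfl | h
    · have hp := isPseudoinverse_pseudoinverse A
      rw [regPseudoinverse_zero]
      refine hs _ hp.right_symm ?_
      rw [← Matrix.mul_assoc, hp.self_mul_mul, sub_self]
      exact PosSemidef.zero
    · rw [regPseudoinverse_of_pos A h, Matrix.mul_assoc]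
      have hG := isUnit_det_gram_add A h
      set G : Matrix κ κ ℝ := Aᵀ * A + lam • (1 : Matrix κ κ ℝ) with hGdef
      have hA : Aᵀ * A = G - lam • (1 : Matrix κ κ ℝ) := by rw [hGdef, add_sub_cancel_right]
      have hGt : Gᵀ = G := by simp [hGdef]
      have e1 : G⁻¹ * (Aᵀ * A) = 1 - lam • G⁻¹ := by
        rw [hA, Matrix.mul_sub, nonsing_inv_mul _ hG, mul_smul_comm, Matrix.mul_one]
      refine hs _ ?_ ?_
      · rw [e1]; simp [transpose_nonsing_inv, hGt]
      · have e2 : G⁻¹ * (Aᵀ * A) - G⁻¹ * (Aᵀ * A) * (G⁻¹ * (Aᵀ * A))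
            = lam • ((A * G⁻¹)ᴴ * (A * G⁻¹)) := by
          have : (A * G⁻¹)ᴴ * (A * G⁻¹) = G⁻¹ * (Aᵀ * A) * G⁻¹ := by
            simp [conjTranspose_eq_transpose_of_trivial, transpose_nonsing_inv, hGt,
              Matrix.mul_assoc]
          rw [this, e1]
          simp only [Matrix.mul_sub, Matrix.sub_mul, Matrix.mul_one, Matrix.one_mul, smul_sub,
            smul_mul_assoc, mul_smul_comm]
          module
        rw [e2]
        exact (posSemidef_conjTranspose_mul_self _).smul h.le
  intro P hP hpsd
  have h1 : (P * P) a a ≤ P a a := by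
    have := hpsd.diag_nonneg (i := a)
    simpa using this
  have h2 : (P * P) a a = ∑ j, P a j ^ 2 := by
    rw [mul_apply]
    refine Finset.sum_congr rfl fun j _ => ?_
    rw [sq]; congr 1
    conv_lhs => rw [← hP, transpose_apply]
  have h3 : ∀ j, P a j ^ 2 ≤ P a a := fun j => by
    have h := (Finset.single_le_sum (f := fun j => P a j ^ 2) (fun i _ => sq_nonneg _)
      (Finset.mem_univ j)).trans (h2.symm.trans_le h1)
    exact h
  have h4 := h3 a
  have h5 : P a a ≤ 1 := by nlinarith
  rw [← sq_le_one_iff_abs_le_one]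
  exact (h3 b).trans h5

/-- The unregularized projector is the limit of the regularized ones, which makes it a measurable
function of the matrix although it is not continuous. -/
theorem tendsto_regPseudoinverse_mul (A : Matrix ι κ ℝ) {t : ℕ → ℝ} (ht : ∀ i, 0 < t i)
    (ht0 : Tendsto t atTop (𝓝 0)) (a b : κ) :
    Tendsto (fun i => (regPseudoinverse A (t i) * A) a b) atTop
      (𝓝 ((regPseudoinverse A 0 * A) a b)) := by
  rw [regPseudoinverse_zero]
  have hp := isPseudoinverse_pseudoinverse A
  set P := pseudoinverse A * A with hP
  -- `A⁺ A` factors through the Gram matrix: `A⁺ A = Aᵀ A (A⁺ A⁺ᵀ)`.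
  have hPG : P = Aᵀ * A * (pseudoinverse A * (pseudoinverse A)ᵀ) := by
    have e1 : Aᵀ * A * pseudoinverse A = Aᵀ := by
      have := congrArg transpose hp.mul_mul_self
      rw [transpose_mul, hp.left_symm] at this
      rw [Matrix.mul_assoc, this]
    rw [← Matrix.mul_assoc, e1, ← transpose_mul, hp.right_symm]
  set N' := pseudoinverse A * (pseudoinverse A)ᵀ
  -- multiply `(Aᵀ A + t) P = Aᵀ A + t P` by `(Aᵀ A + t)⁻¹`; the error is `t` times a bounded matrix
  have key : ∀ i, (regPseudoinverse A (t i) * A) a b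
      = P a b - t i * ∑ j, (regPseudoinverse A (t i) * A) a j * N' j b := fun i => by
    have hG := isUnit_det_gram_add A (ht i)
    have hAP : Aᵀ * A * P = Aᵀ * A := by
      rw [hP, Matrix.mul_assoc, ← Matrix.mul_assoc A, hp.mul_mul_self]
    have : regPseudoinverse A (t i) * A = P - t i • (regPseudoinverse A (t i) * A * N') := by
      rw [regPseudoinverse_of_pos A (ht i)]
      set G : Matrix κ κ ℝ := Aᵀ * A + t i • (1 : Matrix κ κ ℝ) with hGdef
      have e : G * P = Aᵀ * A + t i • P := by
        rw [hGdef, Matrix.add_mul, hAP, smul_mul_assoc, Matrix.one_mul]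
      have e2 : P = G⁻¹ * (Aᵀ * A) + t i • (G⁻¹ * P) := by
        rw [← mul_smul_comm, ← Matrix.mul_add, ← e, nonsing_inv_mul_cancel_left _ _ hG]
      rw [Matrix.mul_assoc, Matrix.mul_assoc, ← hPG]
      exact eq_sub_of_add_eq e2.symm
    conv_lhs => rw [this]
    simp [mul_apply]
  have hlim : Tendsto (fun i => t i * ∑ j, (regPseudoinverse A (t i) * A) a j * N' j b) atTop
      (𝓝 0) := by
    have hb : ∀ i, |∑ j, (regPseudoinverse A (t i) * A) a j * N' j b| ≤ ∑ j, |N' j b| := fun i =>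
      (Finset.abs_sum_le_sum_abs _ _).trans (Finset.sum_le_sum fun j _ => by
        rw [abs_mul]
        exact mul_le_of_le_one_left (abs_nonneg _)
          (abs_regPseudoinverse_mul_apply_le A (ht i).le a j))
    refine squeeze_zero_norm (a := fun i => t i * ∑ j, |N' j b|) (fun i => ?_) ?_
    · rw [Real.norm_eq_abs, abs_mul, abs_of_pos (ht i)]
      exact mul_le_mul_of_nonneg_left (hb i) (ht i).le
    · simpa using ht0.mul_const _
  simp_rw [key]
  simpa using hlim.const_sub (P a b)

end RegProjector

/-! ### Sampling from a determinantal point process -/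

/-- By the matrix determinant lemma, the determinant-weighted projector is a difference of two
determinants; this replaces the inverse matrix by principal minors. The identity persists when the
determinant vanishes, both sides being zero. -/
theorem dotProduct_det_smul_regPseudoinverse_mul {ι κ : Type*} [Fintype ι] [Fintype κ]
    [DecidableEq ι] [DecidableEq κ] (A : Matrix ι κ ℝ) {lam : ℝ} (h : 0 ≤ lam) (u w : κ → ℝ) :
    (A * Aᵀ + lam • (1 : Matrix ι ι ℝ)).det * (u ⬝ᵥ (regPseudoinverse A lam * A) *ᵥ w)
      = (A * Aᵀ + lam • (1 : Matrix ι ι ℝ)).det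
        - (A * Aᵀ + lam • (1 : Matrix ι ι ℝ) - vecMulVec (A *ᵥ w) (A *ᵥ u)).det := by
  by_cases hK : (A * Aᵀ + lam • (1 : Matrix ι ι ℝ)).det = 0
  · have h0 : lam = 0 := by
      by_contra hne
      have := isUnit_det_gram_add Aᵀ (lt_of_le_of_ne h (Ne.symm hne))
      rw [transpose_transpose, hK] at this
      exact not_isUnit_zero this
    subst h0
    rw [hK, zero_mul, zero_sub, zero_eq_neg]
    simp only [zero_smul, add_zero] at hK ⊢
    -- a null vector of `A Aᵀ` is killed by `Aᵀ`, hence is a null vector of the second matrix too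
    obtain ⟨z, hz, hz0⟩ := exists_vecMul_eq_zero_iff.mpr hK
    have hzA : z ᵥ* A = 0 := by
      rw [← dotProduct_self_eq_zero, ← dotProduct_mulVec, ← vecMul_transpose, vecMul_vecMul,
        ← dotProduct_comm, hz0, zero_dotProduct]
    refine exists_vecMul_eq_zero_iff.mp ⟨z, hz, ?_⟩
    rw [vecMul_sub, hz0, vecMul_vecMulVec, dotProduct_mulVec, hzA]
    simp
  · have hu := isUnit_iff_ne_zero.mpr hK
    rw [regPseudoinverse_eq_transpose_mul_inv A h hu]
    set K := A * Aᵀ + lam • (1 : Matrix ι ι ℝ) with hKdef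
    have e : K - vecMulVec (A *ᵥ w) (A *ᵥ u)
        = K + replicateCol Unit (-(A *ᵥ w)) * replicateRow Unit (A *ᵥ u) := by
      rw [← vecMulVec_eq Unit, neg_vecMulVec, sub_eq_add_neg]
    rw [e, det_add_replicateCol_mul_replicateRow hu, Matrix.mul_assoc (replicateRow _ _),
      ← replicateCol_mulVec, det_unique (n := Unit), Matrix.add_apply,
      replicateRow_mul_replicateCol_apply, one_apply_eq]
    have e2 : u ⬝ᵥ (Aᵀ * K⁻¹ * A) *ᵥ w = (A *ᵥ u) ⬝ᵥ K⁻¹ *ᵥ (A *ᵥ w) := by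
      rw [Matrix.mul_assoc, ← mulVec_mulVec, ← mulVec_mulVec, dotProduct_mulVec, vecMul_transpose]
    rw [e2, mulVec_neg, dotProduct_neg]
    ring

/-- Sums of principal minors are coefficients of the characteristic polynomial, hence invariant
under orthogonal conjugation. -/
theorem kDPPNormalizer_conj {m : ℕ} {Q : Matrix (Fin m) (Fin m) ℝ} (hQ : Q * Qᵀ = 1)
    (M : Matrix (Fin m) (Fin m) ℝ) (k : ℕ) :
    kDPPNormalizer (Q * M * Qᵀ) k = kDPPNormalizer M k := by
  by_cases hk : k ≤ Fintype.card (Fin m)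
  · have h1 := charpoly_coeff_eq_sum_minors (Q * M * Qᵀ) k hk
    have h2 := charpoly_coeff_eq_sum_minors M k hk
    obtain ⟨U, hU⟩ : ∃ U : (Matrix (Fin m) (Fin m) ℝ)ˣ, U.val = Q :=
      ⟨⟨Q, Qᵀ, hQ, mul_eq_one_comm.mp hQ⟩, rfl⟩
    have h3 := charpoly_units_conj U M
    rw [hU, inv_eq_right_inv hQ] at h3
    rw [h3, h2] at h1
    exact (mul_left_cancel₀ (pow_ne_zero k (by norm_num)) h1).symm
  · have : (Finset.univ : Finset (Fin m)).powersetCard k = ∅ :=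
      Finset.powersetCard_eq_empty.mpr (by simpa using hk)
    simp [kDPPNormalizer, this]

/-- The bilinear form of the expected projector, expressed through sums of principal minors. -/
theorem dotProduct_expectedProjector_kDPP {m n : ℕ} (J : Matrix (Fin m) (Fin n) ℝ) {lam : ℝ}
    (h : 0 ≤ lam) (k : ℕ) (u w : Fin n → ℝ) :
    u ⬝ᵥ expectedProjector J lam (kDPP (J * Jᵀ + lam • (1 : Matrix (Fin m) (Fin m) ℝ)) k) *ᵥ w
      = (kDPPNormalizer (J * Jᵀ + lam • (1 : Matrix (Fin m) (Fin m) ℝ)) k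
          - kDPPNormalizer (J * Jᵀ + lam • (1 : Matrix (Fin m) (Fin m) ℝ)
            - vecMulVec (J *ᵥ w) (J *ᵥ u)) k)
        / kDPPNormalizer (J * Jᵀ + lam • (1 : Matrix (Fin m) (Fin m) ℝ)) k := by
  set K := J * Jᵀ + lam • (1 : Matrix (Fin m) (Fin m) ℝ) with hK
  have hfilter : (Finset.univ.filter fun S : Finset (Fin m) => S.card = k)
      = (Finset.univ : Finset (Fin m)).powersetCard k := by
    ext S; simp [Finset.mem_powersetCard]
  have e1 : expectedProjector J lam (kDPP K k)
      = ∑ S ∈ (Finset.univ : Finset (Fin m)).powersetCard k,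
        ((K.submatrix (fun i : S => (i : Fin m)) (fun i : S => (i : Fin m))).det
          / kDPPNormalizer K k) • regProjector J lam S := by
    rw [← hfilter, Finset.sum_filter]
    simp only [expectedProjector, kDPP, ite_smul, zero_smul]
  rw [e1, sum_mulVec, dotProduct_sum, sub_div]
  conv_rhs => rw [kDPPNormalizer, kDPPNormalizer, Finset.sum_div, Finset.sum_div,
    ← Finset.sum_sub_distrib]
  refine Finset.sum_congr rfl fun S _ => ?_
  have e2 := dotProduct_det_smul_regPseudoinverse_mul (rowBlock J S) h u w
  rw [← kernel_submatrix, ← hK] at e2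
  have e3 : K.submatrix (fun i : S => (i : Fin m)) (fun i : S => (i : Fin m))
        - vecMulVec (rowBlock J S *ᵥ w) (rowBlock J S *ᵥ u)
      = (K - vecMulVec (J *ᵥ w) (J *ᵥ u)).submatrix
        (fun i : S => (i : Fin m)) (fun i : S => (i : Fin m)) := rfl
  rw [e3] at e2
  rw [smul_mulVec, dotProduct_smul, smul_eq_mul, regProjector, div_mul_eq_mul_div, e2, sub_div]
  rfl

/-- If `v` is a unit eigenvector of `Jᵀ J`, multiplying `J` on the right by the reflection in `v`
amounts to multiplying it on the left by the reflection in `J v`, or by the identity if `J v = 0`. -/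
theorem exists_orthogonal_mul_eq_mul_reflectionMatrix {ι κ : Type*} [Fintype ι] [Fintype κ]
    [DecidableEq ι] [DecidableEq κ] (J : Matrix ι κ ℝ) {v : κ → ℝ} (hv : v ⬝ᵥ v = 1) {β : ℝ}
    (hβ : (Jᵀ * J) *ᵥ v = β • v) :
    ∃ Q : Matrix ι ι ℝ, Q * Qᵀ = 1 ∧ J * reflectionMatrix v = Q * J := by
  have hs : (J *ᵥ v) ⬝ᵥ (J *ᵥ v) = β := by
    rw [dotProduct_mulVec, ← mulVec_transpose, mulVec_mulVec, hβ, smul_dotProduct, hv, smul_eq_mul,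
      mul_one]
  by_cases h0 : J *ᵥ v = 0
  · refine ⟨1, by simp, ?_⟩
    simp [reflectionMatrix, Matrix.mul_sub, mul_vecMulVec, h0]
  · have hpos : 0 < β := by
      rw [← hs]
      exact lt_of_le_of_ne (Finset.sum_nonneg fun i _ => mul_self_nonneg _)
        (Ne.symm (mt dotProduct_self_eq_zero.mp h0))
    have hsq : (√β)⁻¹ * (√β)⁻¹ * β = 1 := by
      rw [← mul_inv, Real.mul_self_sqrt hpos.le, inv_mul_cancel₀ hpos.ne']
    refine ⟨reflectionMatrix ((√β)⁻¹ • J *ᵥ v), ?_, ?_⟩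
    · rw [reflectionMatrix_transpose, reflectionMatrix_mul_self]
      rw [smul_dotProduct, dotProduct_smul, hs, smul_eq_mul, smul_eq_mul, ← mul_assoc, hsq]
    · have e : (J *ᵥ v) ᵥ* J = β • v := by rw [← mulVec_transpose, mulVec_mulVec, hβ]
      simp only [reflectionMatrix, Matrix.mul_sub, Matrix.sub_mul, Matrix.mul_one, Matrix.one_mul,
        Matrix.mul_smul, Matrix.smul_mul, mul_vecMulVec, vecMulVec_mul, e,
        smul_vecMulVec, vecMulVec_smul, smul_smul]
      rw [mul_assoc (2 : ℝ), hsq, mul_one]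

theorem sharesEigenbasis_expectedProjector_kDPP {m n : ℕ} (J : Matrix (Fin m) (Fin n) ℝ) {lam : ℝ}
    (h : 0 ≤ lam) (k : ℕ) :
    SharesEigenbasis
      (expectedProjector J lam (kDPP (J * Jᵀ + lam • (1 : Matrix (Fin m) (Fin m) ℝ)) k))
      (Jᵀ * J) := by
  have hH : (Jᵀ * J).IsHermitian := by
    simpa using isHermitian_conjTranspose_mul_self J
  refine sharesEigenbasis_of_reflectionMatrix_conj hH fun v hv ⟨β, hβ⟩ => ?_
  obtain ⟨Q, hQ, hJ⟩ := exists_orthogonal_mul_eq_mul_reflectionMatrix J hv hβ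
  set K := J * Jᵀ + lam • (1 : Matrix (Fin m) (Fin m) ℝ) with hKdef
  have hK : Q * K * Qᵀ = K := by
    have : Q * (J * Jᵀ) * Qᵀ = J * Jᵀ := by
      calc Q * (J * Jᵀ) * Qᵀ = (Q * J) * (Q * J)ᵀ := by
            simp only [transpose_mul, Matrix.mul_assoc]
        _ = J * (reflectionMatrix v * reflectionMatrix v) * Jᵀ := by
            rw [← hJ, transpose_mul, reflectionMatrix_transpose]
            simp only [Matrix.mul_assoc]
        _ = J * Jᵀ := by rw [reflectionMatrix_mul_self hv, Matrix.mul_one]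
    rw [hKdef, Matrix.mul_add, Matrix.add_mul, this, mul_smul_comm, Matrix.mul_one,
      smul_mul_assoc, hQ]
  refine Matrix.toBilin'.injective (LinearMap.ext₂ fun u w => ?_)
  rw [toBilin'_apply', toBilin'_apply']
  have e1 : u ⬝ᵥ (reflectionMatrix v * expectedProjector J lam (kDPP K k) * reflectionMatrix v) *ᵥ w
      = (reflectionMatrix v *ᵥ u) ⬝ᵥ expectedProjector J lam (kDPP K k) *ᵥ
        (reflectionMatrix v *ᵥ w) := by
    rw [← mulVec_mulVec, ← mulVec_mulVec, dotProduct_mulVec, ← mulVec_transpose,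
      reflectionMatrix_transpose]
  have e2 : K - vecMulVec (Q *ᵥ (J *ᵥ w)) (Q *ᵥ (J *ᵥ u))
      = Q * (K - vecMulVec (J *ᵥ w) (J *ᵥ u)) * Qᵀ := by
    rw [Matrix.mul_sub, Matrix.sub_mul, hK, mul_vecMulVec, vecMulVec_mul, vecMul_transpose]
  rw [e1, dotProduct_expectedProjector_kDPP J h, dotProduct_expectedProjector_kDPP J h, ← hKdef,
    mulVec_mulVec, mulVec_mulVec, hJ, ← mulVec_mulVec, ← mulVec_mulVec, e2, kDPPNormalizer_conj hQ]

/-! ### The strong law of large numbers for bounded U-statistics -/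

/-- Averaging over all permutations of a fixed set is the same as averaging over all sets of the
same size. -/
theorem choose_mul_sum_perm_map {α : Type*} [Fintype α] [DecidableEq α] (f : Finset α → ℝ)
    (B : Finset α) :
    ((Fintype.card α).choose B.card : ℝ) * ∑ σ : Equiv.Perm α, f (B.map σ.toEmbedding)
      = (Fintype.card (Equiv.Perm α) : ℝ) *
        ∑ S ∈ (Finset.univ : Finset α).powersetCard B.card, f S := by
  -- sets of equal size are related by a permutation, which the sum over `σ` absorbs
  have h1 : ∀ B' ∈ (Finset.univ : Finset α).powersetCard B.card,
      ∑ σ : Equiv.Perm α, f (B'.map σ.toEmbedding)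
        = ∑ σ : Equiv.Perm α, f (B.map σ.toEmbedding) := by
    intro B' hB'
    have hc : B.card = B'.card := (Finset.mem_powersetCard.mp hB').2.symm
    obtain ⟨τ, hτ⟩ : ∃ τ : Equiv.Perm α, B.map τ.toEmbedding = B' := by
      refine ⟨(Finset.equivOfCardEq hc).extendSubtype, ?_⟩
      refine Finset.eq_of_subset_of_card_le (fun y hy => ?_) (by rw [Finset.card_map, hc])
      obtain ⟨x, hx, rfl⟩ := Finset.mem_map.mp hy
      exact (Finset.equivOfCardEq hc).extendSubtype_mem x hx
    rw [← Equiv.sum_comp (Equiv.mulRight τ) fun σ => f (B.map σ.toEmbedding)]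
    refine Finset.sum_congr rfl fun σ _ => ?_
    rw [← hτ, Finset.map_map]
    rfl
  have h2 : ∀ σ : Equiv.Perm α,
      ∑ B' ∈ (Finset.univ : Finset α).powersetCard B.card, f (B'.map σ.toEmbedding)
        = ∑ S ∈ (Finset.univ : Finset α).powersetCard B.card, f S := fun σ =>
    Finset.sum_equiv (Equiv.finsetCongr σ) (by simp [Finset.mem_powersetCard]) (fun _ _ => rfl)
  have h3 := Finset.sum_congr rfl h1
  rw [Finset.sum_comm, Finset.sum_congr rfl fun σ _ => h2 σ, Finset.sum_const, Finset.sum_const,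
    Finset.card_powersetCard, Finset.card_univ, Finset.card_univ, nsmul_eq_mul, nsmul_eq_mul] at h3
  exact h3.symm

/-- Sub-Gaussianity survives averaging, whatever the dependence between the variables. -/
theorem hasSubgaussianMGF_average {Ω ι : Type*} [MeasurableSpace Ω] {μ : Measure Ω}
    [IsProbabilityMeasure μ] [Fintype ι] [Nonempty ι] {Y : ι → Ω → ℝ} {c : NNReal}
    (h : ∀ i, HasSubgaussianMGF (Y i) c μ) :
    HasSubgaussianMGF (fun ω => (Fintype.card ι : ℝ)⁻¹ * ∑ i, Y i ω) c μ := by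
  classical
  have hs : ∀ s : Finset ι, HasSubgaussianMGF (fun ω => ∑ i ∈ s, Y i ω) ((s.card : NNReal) ^ 2 * c)
      μ := by
    intro s
    induction s using Finset.induction_on with
    | empty => simp
    | insert i s his ih =>
      have := (h i).add ih
      simp only [Finset.sum_insert his, Finset.card_insert_of_notMem his]
      convert this using 1
      rw [NNReal.sqrt_mul, NNReal.sqrt_sq, ← one_add_mul, mul_pow, NNReal.sq_sqrt, add_comm]
      push_cast
      ring
  have := (hs Finset.univ).const_mul (Fintype.card ι : ℝ)⁻¹
  convert this using 1
  have h0 : (Fintype.card ι : ℝ) ≠ 0 := Nat.cast_ne_zero.mpr Fintype.card_ne_zero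
  rw [← NNReal.coe_inj]
  change (c : ℝ) = (Fintype.card ι : ℝ)⁻¹ ^ 2 *
    (((Finset.univ : Finset ι).card : NNReal) ^ 2 * c : NNReal)
  rw [Finset.card_univ]
  push_cast
  field_simp

section UStatistic

variable {E : Type*} [MeasurableSpace E] (ν : Measure E) [IsProbabilityMeasure ν]

theorem map_infinitePi_comp {ι : Type*} [Fintype ι] {τ : ι → ℕ} (hτ : Function.Injective τ) :
    (Measure.infinitePi fun _ : ℕ => ν).map (fun x i => x (τ i)) = Measure.pi fun _ : ι => ν := by
  rw [Measure.map_infinitePi_infinitePi_of_inj hτ, Measure.infinitePi_eq_pi]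

/-- Tuples of coordinates with disjoint index sets are independent under a product measure. -/
theorem iIndepFun_infinitePi_blocks {ι κ : Type*} [Fintype ι] [Fintype κ] {τ : ι → κ → ℕ}
    (hτ : Function.Injective fun p : (_ : ι) × κ => τ p.1 p.2) :
    iIndepFun (fun j (x : ℕ → E) i => x (τ j i)) (Measure.infinitePi fun _ : ℕ => ν) := by
  rw [iIndepFun_iff_map_fun_eq_infinitePi_map (by fun_prop)]
  have h1 : ∀ j, (Measure.infinitePi fun _ : ℕ => ν).map (fun x i => x (τ j i))
      = Measure.infinitePi fun _ : κ => ν := fun j =>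
    Measure.map_infinitePi_infinitePi_of_inj (P := fun _ : ℕ => ν)
      fun a b hab => by simpa using hτ (a₁ := ⟨j, a⟩) (a₂ := ⟨j, b⟩) hab
  have h2 : (fun (x : ℕ → E) j i => x (τ j i))
      = (MeasurableEquiv.piCurry fun (_ : ι) (_ : κ) => E) ∘
        fun x (p : (_ : ι) × κ) => x (τ p.1 p.2) := rfl
  rw [h2, ← Measure.map_map (by fun_prop) (by fun_prop),
    Measure.map_infinitePi_infinitePi_of_inj (P := fun _ : ℕ => ν) hτ,
    Measure.infinitePi_map_piCurry (fun (_ : ι) (_ : κ) => ν)]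
  simp_rw [h1]

variable {ν} {k : ℕ} {h : (Fin k → E) → ℝ}

theorem integral_infinitePi_comp (hm : Measurable h) {τ : Fin k → ℕ}
    (hτ : Function.Injective τ) :
    ∫ x, h (fun i => x (τ i)) ∂(Measure.infinitePi fun _ : ℕ => ν)
      = ∫ y, h y ∂(Measure.pi fun _ => ν) := by
  rw [← map_infinitePi_comp ν hτ, integral_map _ hm.aestronglyMeasurable]
  exact Measurable.aemeasurable (by fun_prop)

/-- By Hoeffding's lemma, the mean of a bounded kernel over `q` disjoint blocks deviates from its
expectation by a sub-Gaussian variable of parameter `1 / q`. -/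
theorem hasSubgaussianMGF_blocks (hm : Measurable h) (hb : ∀ y, |h y| ≤ 1) {q : ℕ} (hq : q ≠ 0)
    {τ : Fin q → Fin k → ℕ} (hτ : Function.Injective fun p : (_ : Fin q) × Fin k => τ p.1 p.2) :
    HasSubgaussianMGF (fun x : ℕ → E => (q : ℝ)⁻¹ *
        ∑ j, (h (fun i => x (τ j i)) - ∫ y, h y ∂(Measure.pi fun _ => ν))) (q : NNReal)⁻¹
      (Measure.infinitePi fun _ : ℕ => ν) := by
  have hj : ∀ j, Function.Injective (τ j) := fun j a b hab => by
    simpa using hτ (a₁ := ⟨j, a⟩) (a₂ := ⟨j, b⟩) hab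
  have hsub : ∀ j, HasSubgaussianMGF (fun x : ℕ → E =>
      h (fun i => x (τ j i)) - ∫ y, h y ∂(Measure.pi fun _ => ν)) 1
      (Measure.infinitePi fun _ : ℕ => ν) := fun j => by
    have := hasSubgaussianMGF_of_mem_Icc (μ := Measure.infinitePi fun _ : ℕ => ν)
      (X := fun x : ℕ → E => h (fun i => x (τ j i))) (a := -1) (b := 1)
      (hm.comp (by fun_prop)).aemeasurable (ae_of_all _ fun x => abs_le.mp (hb _))
    rw [integral_infinitePi_comp hm (hj j)] at this
    convert this using 1
    -- Hoeffding's parameter for values in `[-1, 1]` is `((1 - (-1)) / 2) ^ 2 = 1`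
    rw [← NNReal.coe_inj]
    norm_num
  have hind := (iIndepFun_infinitePi_blocks ν hτ).comp
    (fun _ y => h y - ∫ y, h y ∂(Measure.pi fun _ => ν)) (fun _ => hm.sub_const _)
  have := (HasSubgaussianMGF.sum_of_iIndepFun hind (s := Finset.univ)
    (fun j _ => hsub j)).const_mul (q : ℝ)⁻¹
  have h0 : (q : ℝ) ≠ 0 := Nat.cast_ne_zero.mpr hq
  convert this using 1
  · rfl
  rw [← NNReal.coe_inj]
  change _ = (q : ℝ)⁻¹ ^ 2 * ((∑ _j : Fin q, 1 : NNReal) : ℝ)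
  simp only [Finset.sum_const, Finset.card_univ, Fintype.card_fin, nsmul_eq_mul, mul_one]
  push_cast
  field_simp

/-- A U-statistic of order `k` of `m` samples is the average over all orderings of the samples of
the mean of the kernel over disjoint blocks; the blocks are spaced by `k + 1` so that `k = 0` needs
no special treatment. -/
theorem hasSubgaussianMGF_uStatistic (hm : Measurable h) (hb : ∀ y, |h y| ≤ 1) {m : ℕ}
    (hq : m / (k + 1) ≠ 0) {f : (ℕ → E) → Finset (Fin m) → ℝ}
    (hf : ∀ x (e : Fin k ↪ Fin m), f x (Finset.univ.map e) = h fun i => x (e i)) :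
    HasSubgaussianMGF (fun x => ∑ S, uniformBlock m k S * f x S
        - ∫ y, h y ∂(Measure.pi fun _ => ν)) ((m / (k + 1) : ℕ) : NNReal)⁻¹
      (Measure.infinitePi fun _ : ℕ => ν) := by
  set q := m / (k + 1)
  set θ := ∫ y, h y ∂(Measure.pi fun _ => ν)
  have hqm : q * (k + 1) ≤ m := Nat.div_mul_le_self m (k + 1)
  have hkm : k ≤ m := by nlinarith [Nat.pos_of_ne_zero hq]
  have hlt : ∀ (j : Fin q) (i : Fin k), (j : ℕ) * (k + 1) + i < m := fun j i => by
    have := j.2; have := i.2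
    nlinarith
  have hinj : ∀ (j j' : Fin q) (i i' : Fin k),
      (j : ℕ) * (k + 1) + i = j' * (k + 1) + i' → j = j' ∧ i = i' := fun j j' i i' e => by
    have hi := i.2; have hi' := i'.2
    have h1 := congrArg (· % (k + 1)) e
    simp only [Nat.mul_add_mod_self_right, Nat.mod_eq_of_lt (show (i : ℕ) < k + 1 by omega),
      Nat.mod_eq_of_lt (show (i' : ℕ) < k + 1 by omega)] at h1
    refine ⟨Fin.ext ?_, Fin.ext h1⟩
    rw [h1] at e
    exact Nat.eq_of_mul_eq_mul_right (Nat.succ_pos k) (Nat.add_right_cancel e)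
  let e : Fin q → Fin k ↪ Fin m := fun j =>
    ⟨fun i => ⟨j * (k + 1) + i, hlt j i⟩, fun i i' hi => (hinj j j i i' (Fin.mk.inj hi)).2⟩
  have hsub : ∀ σ : Equiv.Perm (Fin m), HasSubgaussianMGF (fun x : ℕ → E =>
      (q : ℝ)⁻¹ * ∑ j, (h (fun i => x (σ (e j i))) - θ)) (q : NNReal)⁻¹
      (Measure.infinitePi fun _ : ℕ => ν) := fun σ => by
    refine hasSubgaussianMGF_blocks hm hb hq (τ := fun j i => (σ (e j i) : ℕ)) ?_
    rintro ⟨j, i⟩ ⟨j', i'⟩ hp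
    have hp' := σ.injective (Fin.ext hp)
    obtain ⟨rfl, rfl⟩ := hinj j j' i i' (Fin.mk.inj hp')
    rfl
  refine (hasSubgaussianMGF_average hsub).congr (ae_of_all _ fun x => ?_)
  have hC : (m.choose k : ℝ) ≠ 0 := Nat.cast_ne_zero.mpr (Nat.choose_pos hkm).ne'
  have hP : (Fintype.card (Equiv.Perm (Fin m)) : ℝ) ≠ 0 := Nat.cast_ne_zero.mpr Fintype.card_ne_zero
  have hq0 : (q : ℝ) ≠ 0 := Nat.cast_ne_zero.mpr hq
  have hU : ∑ S, uniformBlock m k S * f x S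
      = (m.choose k : ℝ)⁻¹ * ∑ S ∈ (Finset.univ : Finset (Fin m)).powersetCard k, f x S := by
    have : (Finset.univ.filter fun S : Finset (Fin m) => S.card = k)
        = (Finset.univ : Finset (Fin m)).powersetCard k := by
      ext S; simp [Finset.mem_powersetCard]
    rw [← this, Finset.sum_filter, Finset.mul_sum]
    refine Finset.sum_congr rfl fun S _ => ?_
    unfold uniformBlock
    split_ifs <;> simp
  have hblock : ∀ j, ∑ σ : Equiv.Perm (Fin m), h (fun i => x (σ (e j i)))
      = Fintype.card (Equiv.Perm (Fin m)) * ∑ S, uniformBlock m k S * f x S := fun j => by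
    have := choose_mul_sum_perm_map (f x) (Finset.univ.map (e j))
    simp only [Finset.map_map, hf, Finset.card_map, Finset.card_univ, Fintype.card_fin] at this
    rw [hU, mul_left_comm, ← this, inv_mul_cancel_left₀ hC]
    rfl
  simp only
  rw [← Finset.mul_sum, Finset.sum_comm]
  simp only [Finset.sum_sub_distrib, hblock, Finset.sum_const, Finset.card_univ, Fintype.card_fin,
    nsmul_eq_mul]
  field_simp

/-- The strong law of large numbers for U-statistics with a bounded kernel `h`. The values of `h`
on blocks are presented as a set function `f`, which encodes that `h` is symmetric. -/
theorem ae_tendsto_uStatistic (hm : Measurable h) (hb : ∀ y, |h y| ≤ 1)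
    {f : (m : ℕ) → (ℕ → E) → Finset (Fin m) → ℝ}
    (hf : ∀ m x (e : Fin k ↪ Fin m), f m x (Finset.univ.map e) = h fun i => x (e i)) :
    ∀ᵐ x ∂(Measure.infinitePi fun _ : ℕ => ν),
      Tendsto (fun m => ∑ S, uniformBlock m k S * f m x S) atTop
        (𝓝 (∫ y, h y ∂(Measure.pi fun _ => ν))) := by
  set θ := ∫ y, h y ∂(Measure.pi fun _ => ν)
  set μ := Measure.infinitePi fun _ : ℕ => ν
  set U : ℕ → (ℕ → E) → ℝ := fun m x => ∑ S, uniformBlock m k S * f m x S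
  have tail : ∀ ε : ℝ, 0 < ε → ∀ m, μ {x | ε ≤ |U m x - θ|}
      ≤ ENNReal.ofReal (2 * Real.exp (-(ε ^ 2 / 2) * (m / (k + 1) : ℕ))) := by
    intro ε hε m
    refine (ofReal_measureReal (μ := μ)).symm.trans_le (ENNReal.ofReal_le_ofReal ?_)
    by_cases hq : m / (k + 1) = 0
    · rw [hq]
      have : μ.real {x | ε ≤ |U m x - θ|} ≤ 1 := measureReal_le_one
      simp only [Nat.cast_zero, mul_zero, Real.exp_zero]
      linarith
    · have hs := hasSubgaussianMGF_uStatistic (ν := ν) hm hb hq (hf m)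
      have hx : -ε ^ 2 / (2 * (((m / (k + 1) : ℕ) : NNReal)⁻¹ : NNReal))
          = -(ε ^ 2 / 2) * (m / (k + 1) : ℕ) := by
        have h0 : ((m / (k + 1) : ℕ) : ℝ) ≠ 0 := Nat.cast_ne_zero.mpr hq
        rw [NNReal.coe_inv, NNReal.coe_natCast]
        field_simp
      have h1 := hs.measure_ge_le hε.le
      have h2 := hs.neg.measure_ge_le hε.le
      rw [hx] at h1 h2
      refine (measureReal_mono (s₂ := {x | ε ≤ U m x - θ} ∪ {x | ε ≤ -(U m x - θ)})
        fun x hx => le_abs.mp (show ε ≤ |U m x - θ| from hx)).trans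
        ((measureReal_union_le _ _).trans ?_)
      rw [two_mul]
      exact add_le_add h1 h2
  have hsum : ∀ ε : ℝ, 0 < ε →
      Summable fun m : ℕ => 2 * Real.exp (-(ε ^ 2 / 2) * (m / (k + 1) : ℕ)) := by
    intro ε hε
    set a := ε ^ 2 / 2 with ha
    have ha0 : 0 < a := by positivity
    have hK : (0 : ℝ) < (k + 1 : ℕ) := by positivity
    refine Summable.mul_left 2 ?_
    have hg : Summable fun m : ℕ => Real.exp a * Real.exp (m * -(a / (k + 1 : ℕ))) :=
      (Real.summable_exp_nat_mul_iff.mpr (by rw [neg_lt_zero]; positivity)).mul_left _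
    refine hg.of_nonneg_of_le (fun m => (Real.exp_pos _).le) fun m => ?_
    -- rounding down in `m / (k + 1)` costs at most a factor `exp a` over a geometric series
    rw [← Real.exp_add, Real.exp_le_exp]
    have h1 : (m : ℝ) / (k + 1 : ℕ) ≤ (m / (k + 1) : ℕ) + 1 := by
      rw [div_le_iff₀ hK]
      exact_mod_cast (Nat.lt_div_mul_add (Nat.succ_pos k)).le.trans_eq
        (Nat.succ_mul _ _).symm
    have h2 := mul_le_mul_of_nonneg_left h1 ha0.le
    have h3 : (m : ℝ) * -(a / (k + 1 : ℕ)) = -(a * (m / (k + 1 : ℕ))) := by ring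
    rw [h3]
    linarith
  have hev : ∀ l : ℕ, ∀ᵐ x ∂μ, ∀ᶠ m in atTop, |U m x - θ| < 1 / ((l : ℝ) + 1) := fun l => by
    have hl : (0 : ℝ) < 1 / ((l : ℝ) + 1) := Nat.one_div_pos_of_nat
    have := ae_eventually_notMem (μ := μ) (s := fun m => {x | 1 / ((l : ℝ) + 1) ≤ |U m x - θ|})
      (ne_top_of_le_ne_top (hsum _ hl).tsum_ofReal_ne_top (ENNReal.tsum_le_tsum (tail _ hl)))
    filter_upwards [this] with x hx
    filter_upwards [hx] with m hm
    exact not_le.mp hm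
  filter_upwards [ae_all_iff.mpr hev] with x hx
  rw [Metric.tendsto_nhds]
  intro ε hε
  obtain ⟨l, hl⟩ := exists_nat_one_div_lt hε
  filter_upwards [hx l] with m hm
  exact (Real.dist_eq _ _).trans_lt (hm.trans hl)

end UStatistic

/-! ### Gaussian rows -/

theorem reflectionMatrix_conj_of_mulVec_eq_smul {ι : Type*} [Fintype ι] [DecidableEq ι]
    {B : Matrix ι ι ℝ} (hB : Bᵀ = B) {v : ι → ℝ} (hv : v ⬝ᵥ v = 1) {β : ℝ}
    (hβ : B *ᵥ v = β • v) : reflectionMatrix v * B * reflectionMatrix v = B := by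
  have h1 : v ᵥ* B = β • v := by rw [← mulVec_transpose, hB, hβ]
  have h2 : reflectionMatrix v * B = B * reflectionMatrix v := by
    simp only [reflectionMatrix, Matrix.mul_sub, Matrix.sub_mul, Matrix.mul_one, Matrix.one_mul,
      Matrix.mul_smul, Matrix.smul_mul, mul_vecMulVec, vecMulVec_mul, h1, hβ, smul_vecMulVec,
      vecMulVec_smul]
  rw [h2, Matrix.mul_assoc, reflectionMatrix_mul_self hv, Matrix.mul_one]

/-- A centred Gaussian law is invariant under every linear map that preserves its covariance. -/
theorem map_multivariateGaussian_eq_self {ι : Type*} [Fintype ι] [DecidableEq ι]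
    {S R : Matrix ι ι ℝ} (hS : S.PosSemidef) (hR : R * S * Rᵀ = S) :
    (multivariateGaussian 0 S).map (toEuclideanCLM (𝕜 := ℝ) R) = multivariateGaussian 0 S := by
  refine Measure.ext_of_charFun (funext fun t => ?_)
  have h1 : charFun ((multivariateGaussian 0 S).map (toEuclideanCLM (𝕜 := ℝ) R)) t
      = charFun (multivariateGaussian 0 S) (toEuclideanCLM (𝕜 := ℝ) Rᵀ t) := by
    rw [charFun_apply, charFun_apply, integral_map (by fun_prop) (by fun_prop)]
    have : ∀ x, inner ℝ (toEuclideanCLM (𝕜 := ℝ) R x) t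
        = inner ℝ x (toEuclideanCLM (𝕜 := ℝ) Rᵀ t) := fun x => by
      rw [EuclideanSpace.inner_eq_star_dotProduct, EuclideanSpace.inner_eq_star_dotProduct]
      simp [ofLp_toEuclideanCLM, dotProduct_mulVec, mulVec_transpose]
    simp_rw [this]
  rw [h1, charFun_multivariateGaussian hS, charFun_multivariateGaussian hS]
  have h2 : (Rᵀ *ᵥ t.ofLp) ⬝ᵥ S *ᵥ (Rᵀ *ᵥ t.ofLp) = t.ofLp ⬝ᵥ S *ᵥ t.ofLp := by
    conv_rhs => rw [← hR]
    rw [← mulVec_mulVec, ← mulVec_mulVec, dotProduct_mulVec t.ofLp R, mulVec_transpose]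
  simp only [inner_zero_right, ofLp_toEuclideanCLM, h2]

theorem integral_mul_multivariateGaussian {ι : Type*} [Fintype ι] [DecidableEq ι]
    {S : Matrix ι ι ℝ} (hS : S.PosSemidef) (a b : ι) :
    Integrable (fun x : EuclideanSpace ℝ ι => x a * x b) (multivariateGaussian 0 S) ∧
      ∫ x, x a * x b ∂(multivariateGaussian 0 S) = S a b := by
  have hL : ∀ i, MemLp (fun x : EuclideanSpace ℝ ι => x i) 2 (multivariateGaussian 0 S) := fun i =>
    (EuclideanSpace.proj (𝕜 := ℝ) i).comp_memLp' IsGaussian.memLp_two_id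
  have h0 : ∀ i, ∫ x : EuclideanSpace ℝ ι, x i ∂(multivariateGaussian 0 S) = 0 := fun i => by
    have := (EuclideanSpace.proj (𝕜 := ℝ) i).integral_comp_id_comm
      (μ := multivariateGaussian 0 S) IsGaussian.integrable_id
    simpa using this
  refine ⟨(hL a).integrable_mul (hL b), ?_⟩
  have h := covariance_eval_multivariateGaussian (μ := 0) hS a b
  rw [covariance_eq_sub (hL a) (hL b), h0 a, zero_mul, sub_zero] at h
  exact h

/-- The regularized projector attached to a tuple of rows. -/
noncomputable def sampleProjector {k n : ℕ} (lam : ℝ) (y : Fin k → EuclideanSpace ℝ (Fin n)) :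
    Matrix (Fin n) (Fin n) ℝ :=
  regPseudoinverse (Matrix.of fun i j => y i j) lam * Matrix.of fun i j => y i j

theorem regProjector_firstRows_map {k m n : ℕ} {lam : ℝ} (h : 0 ≤ lam)
    (x : ℕ → EuclideanSpace ℝ (Fin n)) (e : Fin k ↪ Fin m) :
    regProjector (firstRows x m) lam (Finset.univ.map e)
      = sampleProjector lam fun i => x (e i) := by
  let e' : Fin k ≃ (Finset.univ.map e : Finset (Fin m)) :=
    Equiv.ofBijective (fun i => ⟨e i, Finset.mem_map_of_mem e (Finset.mem_univ i)⟩)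
      ⟨fun i j hij => e.injective (congrArg Subtype.val hij), fun ⟨y, hy⟩ => by
        obtain ⟨i, -, rfl⟩ := Finset.mem_map.mp hy
        exact ⟨i, rfl⟩⟩
  exact (regPseudoinverse_submatrix_mul (rowBlock (firstRows x m) (Finset.univ.map e)) h e').symm

theorem measurable_sampleProjector_apply {k n : ℕ} {lam : ℝ} (h : 0 ≤ lam) (a b : Fin n) :
    Measurable fun y : Fin k → EuclideanSpace ℝ (Fin n) => sampleProjector lam y a b := by
  have hpos : ∀ lam : ℝ, 0 < lam →
      Measurable fun y : Fin k → EuclideanSpace ℝ (Fin n) => sampleProjector lam y a b := by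
    intro lam h
    refine Continuous.measurable ?_
    have hA : Continuous fun y : Fin k → EuclideanSpace ℝ (Fin n) =>
        (Matrix.of fun i j => y i j : Matrix (Fin k) (Fin n) ℝ) :=
      continuous_matrix fun i j => by simp only [of_apply]; fun_prop
    have hG : Continuous fun y : Fin k → EuclideanSpace ℝ (Fin n) =>
        (Matrix.of fun i j => y i j : Matrix (Fin k) (Fin n) ℝ)ᵀ *
          (Matrix.of fun i j => y i j) + lam • (1 : Matrix (Fin n) (Fin n) ℝ) :=
      (hA.matrix_transpose.matrix_mul hA).add continuous_const
    simp only [sampleProjector, regPseudoinverse_of_pos _ h, inv_def, Ring.inverse_eq_inv']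
    exact (((((hG.matrix_det).inv₀ fun y => (isUnit_det_gram_add _ h).ne_zero).smul
      hG.matrix_adjugate).matrix_mul hA.matrix_transpose).matrix_mul hA).matrix_elem a b
  rcases h.eq_or_lt with rfl | h
  · refine measurable_of_tendsto_metrizable
      (fun i : ℕ => hpos (1 / ((i : ℝ) + 1)) Nat.one_div_pos_of_nat)
      (tendsto_pi_nhds.mpr fun y => ?_)
    exact tendsto_regPseudoinverse_mul _ (fun i => Nat.one_div_pos_of_nat)
      tendsto_one_div_add_atTop_nhds_zero_nat a b
  · exact hpos lam h

theorem abs_sampleProjector_apply_le {k n : ℕ} {lam : ℝ} (h : 0 ≤ lam)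
    (y : Fin k → EuclideanSpace ℝ (Fin n)) (a b : Fin n) : |sampleProjector lam y a b| ≤ 1 :=
  abs_regPseudoinverse_mul_apply_le _ h a b

theorem sampleProjector_comp_toEuclideanCLM {k n : ℕ} {lam : ℝ} (h : 0 ≤ lam)
    (y : Fin k → EuclideanSpace ℝ (Fin n)) {Q : Matrix (Fin n) (Fin n) ℝ} (hQ : Qᵀ * Q = 1) :
    sampleProjector lam (fun i => toEuclideanCLM (𝕜 := ℝ) Qᵀ (y i))
      = Qᵀ * sampleProjector lam y * Q := by
  have : (Matrix.of fun i j => toEuclideanCLM (𝕜 := ℝ) Qᵀ (y i) j : Matrix (Fin k) (Fin n) ℝ)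
      = (Matrix.of fun i j => y i j) * Q := by
    ext i j
    rw [of_apply, ofLp_toEuclideanCLM, mulVec_transpose, mul_apply]
    rfl
  rw [sampleProjector, this, regPseudoinverse_mul_orthogonal_right _ h hQ]
  rfl

/-- The expected regularized projector of `k` independent rows with law `N(0, Sig)`. -/
noncomputable def gaussianProjector {n : ℕ} (k : ℕ) (lam : ℝ) (Sig : Matrix (Fin n) (Fin n) ℝ) :
    Matrix (Fin n) (Fin n) ℝ :=
  Matrix.of fun a b => ∫ y : Fin k → EuclideanSpace ℝ (Fin n), sampleProjector lam y a b
    ∂(Measure.pi fun _ => multivariateGaussian 0 Sig)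

theorem integrable_sampleProjector_apply {k n : ℕ} {lam : ℝ} (h : 0 ≤ lam)
    (μ : Measure (Fin k → EuclideanSpace ℝ (Fin n))) [IsFiniteMeasure μ] (a b : Fin n) :
    Integrable (fun y => sampleProjector lam y a b) μ :=
  Integrable.of_bound (measurable_sampleProjector_apply h a b).aestronglyMeasurable 1
    (ae_of_all _ fun y => abs_sampleProjector_apply_le h y a b)

theorem sharesEigenbasis_gaussianProjector {n : ℕ} (k : ℕ) {lam : ℝ} (h : 0 ≤ lam)
    {Sig : Matrix (Fin n) (Fin n) ℝ} (hS : Sig.PosSemidef) :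
    SharesEigenbasis (gaussianProjector k lam Sig) Sig := by
  have hSt : Sigᵀ = Sig := by simpa [Matrix.IsHermitian] using hS.isHermitian
  refine sharesEigenbasis_of_reflectionMatrix_conj hS.isHermitian fun v hv ⟨β, hβ⟩ => ?_
  set R := reflectionMatrix v
  have hRt : Rᵀ = R := reflectionMatrix_transpose v
  have hRR : Rᵀ * R = 1 := by rw [hRt]; exact reflectionMatrix_mul_self hv
  set ν := multivariateGaussian (0 : EuclideanSpace ℝ (Fin n)) Sig with hν
  have hmap : ν.map (toEuclideanCLM (𝕜 := ℝ) Rᵀ) = ν :=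
    map_multivariateGaussian_eq_self hS
      (by rw [hRt, hRt]; exact reflectionMatrix_conj_of_mulVec_eq_smul hSt hv hβ)
  have hpi : (Measure.pi fun _ : Fin k => ν).map
      (fun y i => toEuclideanCLM (𝕜 := ℝ) Rᵀ (y i)) = Measure.pi fun _ => ν := by
    have : ∀ _ : Fin k, SigmaFinite (ν.map (toEuclideanCLM (𝕜 := ℝ) Rᵀ)) := fun _ => by
      rw [hmap]; infer_instance
    rw [Measure.pi_map_pi (μ := fun _ : Fin k => ν)
      (f := fun _ => toEuclideanCLM (𝕜 := ℝ) Rᵀ) (fun _ => by fun_prop)]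
    simp_rw [hmap]
  ext a b
  have hint : ∀ c d, Integrable (fun y => sampleProjector lam y c d)
      (Measure.pi fun _ : Fin k => ν) := fun c d => integrable_sampleProjector_apply h _ c d
  calc (R * gaussianProjector k lam Sig * R) a b
      = ∫ y, (Rᵀ * sampleProjector lam y * R) a b ∂(Measure.pi fun _ : Fin k => ν) := by
        rw [hRt]
        simp only [mul_apply, gaussianProjector, of_apply, Finset.sum_mul]
        rw [integral_finsetSum _ fun c _ => integrable_finsetSum _ fun d _ =>
          ((hint d c).const_mul _).mul_const _]
        refine Finset.sum_congr rfl fun c _ => ?_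
        rw [integral_finsetSum _ fun d _ => ((hint d c).const_mul _).mul_const _]
        refine Finset.sum_congr rfl fun d _ => ?_
        rw [integral_mul_const, integral_const_mul]
    _ = ∫ y, sampleProjector lam (fun i => toEuclideanCLM (𝕜 := ℝ) Rᵀ (y i)) a b
          ∂(Measure.pi fun _ : Fin k => ν) := by
        simp_rw [sampleProjector_comp_toEuclideanCLM h _ hRR]
    _ = gaussianProjector k lam Sig a b := by
        rw [gaussianProjector, of_apply]
        conv_rhs => rw [← hν, ← hpi]
        rw [integral_map (Measurable.aemeasurable (by fun_prop))
          (measurable_sampleProjector_apply h a b).aestronglyMeasurable]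

section StrongLaw

variable {Ω : Type*} [MeasurableSpace Ω] {μ : Measure Ω} {n : ℕ}
  {X : ℕ → Ω → EuclideanSpace ℝ (Fin n)} {Sig : Matrix (Fin n) (Fin n) ℝ}

theorem ae_tendsto_expectedProjector (k : ℕ) {lam : ℝ} (h : 0 ≤ lam) (hX : iIndepFun X μ)
    (hlaw : ∀ i, HasLaw (X i) (multivariateGaussian 0 Sig) μ) :
    ∀ᵐ ω ∂μ, Tendsto (fun m : ℕ => expectedProjector (firstRows (fun i => X i ω) m) lam
      (uniformBlock m k)) atTop (𝓝 (gaussianProjector k lam Sig)) := by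
  have hm : AEMeasurable (fun ω i => X i ω) μ := aemeasurable_pi_iff.mpr fun i =>
    (hlaw i).aemeasurable
  have hjoint := hX.hasLaw_infinitePi hlaw hm
  have hae : ∀ a b, ∀ᵐ ω ∂μ, Tendsto (fun m : ℕ => ∑ S, uniformBlock m k S *
      regProjector (firstRows (fun i => X i ω) m) lam S a b) atTop
      (𝓝 (gaussianProjector k lam Sig a b)) := fun a b => by
    have := ae_tendsto_uStatistic (ν := multivariateGaussian (0 : EuclideanSpace ℝ (Fin n)) Sig)
      (h := fun y : Fin k → _ => sampleProjector lam y a b)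
      (f := fun m x S => regProjector (firstRows x m) lam S a b)
      (measurable_sampleProjector_apply h a b) (fun y => abs_sampleProjector_apply_le h y a b)
      (fun m x e => by rw [regProjector_firstRows_map h])
    rw [← hjoint.map_eq] at this
    exact ae_of_ae_map hm this
  filter_upwards [ae_all_iff.mpr fun a => ae_all_iff.mpr (hae a)] with ω hω
  refine tendsto_pi_nhds.mpr fun a => tendsto_pi_nhds.mpr fun b => ?_
  simpa [expectedProjector, Matrix.sum_apply] using hω a b

theorem ae_tendsto_sampleCovariance (hS : Sig.PosSemidef) (hX : iIndepFun X μ)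
    (hlaw : ∀ i, HasLaw (X i) (multivariateGaussian 0 Sig) μ) :
    ∀ᵐ ω ∂μ, Tendsto (fun m : ℕ => (1 / (m : ℝ)) • ((firstRows (fun i => X i ω) m)ᵀ *
      firstRows (fun i => X i ω) m)) atTop (𝓝 Sig) := by
  have hae : ∀ a b, ∀ᵐ ω ∂μ, Tendsto (fun m : ℕ =>
      (∑ i ∈ Finset.range m, X i ω a * X i ω b) / (m : ℝ)) atTop (𝓝 (Sig a b)) := fun a b => by
    obtain ⟨hint, hval⟩ := integral_mul_multivariateGaussian hS a b
    have hg : Measurable fun x : EuclideanSpace ℝ (Fin n) => x a * x b := by fun_prop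
    have hmap : ∀ i, μ.map (fun ω => X i ω a * X i ω b)
        = (multivariateGaussian 0 Sig).map fun x => x a * x b := fun i => by
      rw [← (hlaw i).map_eq, AEMeasurable.map_map_of_aemeasurable hg.aemeasurable
        (hlaw i).aemeasurable]
      rfl
    have hmeas : ∀ i, AEMeasurable (fun ω => X i ω a * X i ω b) μ := fun i =>
      hg.comp_aemeasurable (hlaw i).aemeasurable
    have hmean : ∫ ω, X 0 ω a * X 0 ω b ∂μ = Sig a b := by
      rw [← hval]
      exact (hlaw 0).integral_comp (f := fun x => x a * x b) hg.aestronglyMeasurable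
    rw [← hmean]
    refine strong_law_ae_real (fun i ω => X i ω a * X i ω b) ?_ (fun i j hij => ?_) fun i =>
      ⟨hmeas i, hmeas 0, (hmap i).trans (hmap 0).symm⟩
    · have h0 := (hlaw 0).map_eq
      rw [← h0] at hint
      exact hint.comp_aemeasurable (hlaw 0).aemeasurable
    · exact (hX.indepFun hij).comp hg hg
  filter_upwards [ae_all_iff.mpr fun a => ae_all_iff.mpr (hae a)] with ω hω
  refine tendsto_pi_nhds.mpr fun a => tendsto_pi_nhds.mpr fun b => ?_
  refine (hω a b).congr fun m => ?_
  rw [Matrix.smul_apply, mul_apply, smul_eq_mul, one_div, div_eq_inv_mul,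
    ← Fin.sum_univ_eq_sum_range fun i => X i ω a * X i ω b]
  rfl

end StrongLaw

theorem mainTheorem7 :
    (∀ (m n k : ℕ) (J : Matrix (Fin m) (Fin n) ℝ) (lam : ℝ), 0 ≤ lam →
      kDPPNormalizer (J * Jᵀ + lam • (1 : Matrix (Fin m) (Fin m) ℝ)) k ≠ 0 →
      SharesEigenbasis
        (expectedProjector J lam (kDPP (J * Jᵀ + lam • (1 : Matrix (Fin m) (Fin m) ℝ)) k))
        (Jᵀ * J)) ∧
    (∀ (n k : ℕ) (lam : ℝ) (Sig : Matrix (Fin n) (Fin n) ℝ), 0 ≤ lam → Sig.PosSemidef →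
      ∃ Plim : Matrix (Fin n) (Fin n) ℝ, SharesEigenbasis Plim Sig ∧
        ∀ (Ω : Type*) [MeasurableSpace Ω] (μ : Measure Ω) [IsProbabilityMeasure μ]
          (X : ℕ → Ω → EuclideanSpace ℝ (Fin n)),
          iIndepFun X μ → (∀ i, HasLaw (X i) (multivariateGaussian 0 Sig) μ) →
          ∀ᵐ ω ∂μ,
            Tendsto (fun m : ℕ => expectedProjector (firstRows (fun i => X i ω) m) lam
              (uniformBlock m k)) atTop (𝓝 Plim) ∧
            Tendsto (fun m : ℕ => (1 / (m : ℝ)) • ((firstRows (fun i => X i ω) m)ᵀ *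
              firstRows (fun i => X i ω) m)) atTop (𝓝 Sig)) := by
  refine ⟨fun m n k J lam h _ => sharesEigenbasis_expectedProjector_kDPP J h k,
    fun n k lam Sig h hS => ⟨gaussianProjector k lam Sig, sharesEigenbasis_gaussianProjector k h hS,
      fun Ω _ μ _ X hX hlaw => ?_⟩⟩
  filter_upwards [ae_tendsto_expectedProjector k h hX hlaw,
    ae_tendsto_sampleCovariance hS hX hlaw] with ω h1 h2
  exact ⟨h1, h2⟩
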